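/- Let $m\ge 1$ and $N\ge 2m$ be integers, let $\Omega\subset\mathbb{R}^N$ be an open set with $0\in\Omega$, and put $\Omega'=\Omega\setminus\{0\}$. Let $g:\Omega'\times[0,\infty)\to[0,\infty)$ be (Lebesgue) measurable, and let $u:\Omega'\to\mathbb{R}$ satisfy $\Delta^k u\in L^1_{loc}(\Omega')$ for $k=0,1,\dots,m$, where $\Delta^k u$ is taken in the sense of distributions in $\Omega'$. Suppose that $(-\Delta)^k u\ge 0$ a.e. in $\Omega'$ for $k=0,1,\dots,m-1$ (in particular $u\ge0$ a.e., so that $g(x,u(x))$ is defined a.e. in $\Omega'$), and that $$(-\Delta)^m u=g(x,u)\quad\text{in }\mathcal{D}'(\Omega').$$ Then $u\in L^1_{loc}(\Omega)$ and $g(x,u)\in L^1_{loc}(\Omega)$, and there exist constants $\alpha_0,\dots,\alpha_{m-1}\ge 0$ such that $$(-\Delta)^m u=g(x,u)+\sum_{i=0}^{m-1}\alpha_i(-\Delta)^i\delta_0\quad\text{in }\mathcal{D}'(\Omega),$$ where $\delta_0$ is the Dirac mass at the origin. In particular this holds when $\Omega$ is a bounded domain with smooth boundary. -/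

import Mathlib

open MeasureTheory TopologicalSpace
open scoped Distributions

noncomputable section

/-- The punctured open set `Ω' = Ω \ {0}`. -/
def punctured {N : ℕ} (Ω : Opens (EuclideanSpace ℝ (Fin N))) : Opens (EuclideanSpace ℝ (Fin N)) :=
  ⟨(Ω : Set (EuclideanSpace ℝ (Fin N))) \ {0}, Ω.isOpen.sdiff isClosed_singleton⟩

/-- The regular distribution `φ ↦ ∫ φ f` on `Ω` defined by `f ∈ L¹_loc(Ω)`
(meaningful only for `f` locally integrable on `Ω`; Mathlib's convention gives `0` otherwise). -/
def distOf {N : ℕ} (Ω : Opens (EuclideanSpace ℝ (Fin N))) (f : EuclideanSpace ℝ (Fin N) → ℝ) :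
    𝓓'(Ω, ℝ) :=
  (TestFunction.integralAgainstBilinCLM (ContinuousLinearMap.mul ℝ ℝ) volume f :
    𝓓(Ω, ℝ) →L[ℝ] ℝ)

/-- The operator `-Δ` on the distributions on `Ω`. -/
def negLaplacian {N : ℕ} (Ω : Opens (EuclideanSpace ℝ (Fin N))) : 𝓓'(Ω, ℝ) →L[ℝ] 𝓓'(Ω, ℝ) :=
  -LineDeriv.laplacianCLM ℝ (EuclideanSpace ℝ (Fin N)) 𝓓'(Ω, ℝ)

/-- `u, v ∈ L¹_loc(Ω)` and `(-Δ)^k u = v` in `𝓓'(Ω)`. In particular `(-Δ)^k u`, equivalently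
`Δ^k u`, belongs to `L¹_loc(Ω)`. -/
def IsWeakPolyLaplacian {N : ℕ} (Ω : Opens (EuclideanSpace ℝ (Fin N))) (k : ℕ)
    (u v : EuclideanSpace ℝ (Fin N) → ℝ) : Prop :=
  LocallyIntegrableOn u Ω ∧ LocallyIntegrableOn v Ω ∧
    (negLaplacian Ω ^ k) (distOf Ω u) = distOf Ω v

end

open Filter
open scoped ContDiff Topology

/-! Put `v 0 = u`, `v k = (-Δ)^k u` and `v m = g(x,u)`. Consecutive terms satisfy `-Δ (v k) = v
(k+1)` off the origin and all are nonnegative, so the theorem is the Brézis–Lions lemma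
(`exists_negLaplacian_eq_add_delta_of_nonneg`) applied `m` times: each application adds a
nonnegative Dirac mass, and later applications of `-Δ` turn it into `(-Δ)^i δ₀`.

The Brézis–Lions lemma, for `-Δ u = f` with `u, f ≥ 0`, rests on the cut-offs `ζ_n = P(1 + log ‖x‖²
/ (n+1))`, with `P` smooth, convex, nondecreasing and zero on `(-∞, 0]`. They vanish near the
origin, tend to `P(1) > 0` elsewhere, and are subharmonic off the origin because `log ‖x‖` is so
when `N ≥ 2`.

Integrability (`exists_integrableOn_ball`): test the equation with `η (1 + ‖x‖) ζ_n`. Near the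
origin every term is nonnegative, and `Δ‖x‖ = (N-1)/‖x‖` contributes `ζ_n u / ‖x‖`; away from it the
terms are bounded below uniformly in `n`. Fatou gives `f` and `u / ‖x‖` integrable near the origin.

Defect (`exists_negLaplacian_eq_add_delta`): for `T = -Δ u - f` on `Ω`, `P(1) T φ` is the limit of
`∫ (2 ∇φ·∇ζ_n + φ Δζ_n) u`. The gradient term is `O(u / ((n+1)‖x‖))` and disappears. If `φ(0) = 0`
the other term has the same order, so `T φ = 0`; if `φ ≥ 0` it is nonnegative, so `T φ ≥ 0`. Hence
`T = α δ₀` with `α ≥ 0`. -/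

/-- The partial derivative of `φ` along the vector `v`. -/
noncomputable def dirDeriv {N : ℕ} (v : EuclideanSpace ℝ (Fin N)) (φ : EuclideanSpace ℝ (Fin N) → ℝ) :
    EuclideanSpace ℝ (Fin N) → ℝ := fun x => fderiv ℝ φ x v

/-- The `i`-th vector of the standard basis. -/
noncomputable abbrev stdVec {N : ℕ} (i : Fin N) : EuclideanSpace ℝ (Fin N) :=
  EuclideanSpace.basisFun (Fin N) ℝ i

/-- The pointwise Laplacian, as a sum of second partial derivatives. -/
noncomputable def lap {N : ℕ} (φ : EuclideanSpace ℝ (Fin N) → ℝ) :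
    EuclideanSpace ℝ (Fin N) → ℝ := fun x => ∑ i, dirDeriv (stdVec i) (dirDeriv (stdVec i) φ) x

/-- The scalar product of the gradients of `φ` and `ψ`. -/
noncomputable def gradDot {N : ℕ} (φ ψ : EuclideanSpace ℝ (Fin N) → ℝ) :
    EuclideanSpace ℝ (Fin N) → ℝ := fun x => ∑ i, dirDeriv (stdVec i) φ x * dirDeriv (stdVec i) ψ x

/-! ### Pointwise calculus: product rule and radial functions. -/

section Calculus

variable {N : ℕ} {φ ψ : EuclideanSpace ℝ (Fin N) → ℝ} {x v : EuclideanSpace ℝ (Fin N)}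

theorem contDiffAt_dirDeriv {n m : WithTop ℕ∞} (h : ContDiffAt ℝ n φ x) (hm : m + 1 ≤ n) :
    ContDiffAt ℝ m (dirDeriv v φ) x :=
  ContDiffAt.clm_apply (f := fderiv ℝ φ) (h.fderiv_right hm) contDiffAt_const

theorem dirDeriv_congr (h : φ =ᶠ[𝓝 x] ψ) : dirDeriv v φ =ᶠ[𝓝 x] dirDeriv v ψ := by
  filter_upwards [h.fderiv (𝕜 := ℝ)] with y hy
  simp only [dirDeriv, hy]

theorem lap_congr (h : φ =ᶠ[𝓝 x] ψ) : lap φ x = lap ψ x :=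
  Finset.sum_congr rfl fun _ _ => (dirDeriv_congr (dirDeriv_congr h)).eq_of_nhds

theorem lap_eq_zero (h : φ =ᶠ[𝓝 x] 0) : lap φ x = 0 := by
  rw [lap_congr h]
  have h0 : ∀ v : EuclideanSpace ℝ (Fin N),
      dirDeriv v (0 : EuclideanSpace ℝ (Fin N) → ℝ) = 0 := by
    intro v
    funext y
    simp [dirDeriv]
  simp [lap, h0]

theorem gradDot_congr_left {φ' : EuclideanSpace ℝ (Fin N) → ℝ} (h : φ =ᶠ[𝓝 x] φ') :
    gradDot φ ψ x = gradDot φ' ψ x :=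
  Finset.sum_congr rfl fun i _ => by rw [(dirDeriv_congr h).eq_of_nhds]

theorem dirDeriv_mul (hφ : DifferentiableAt ℝ φ x) (hψ : DifferentiableAt ℝ ψ x) :
    dirDeriv v (fun y => φ y * ψ y) x = φ x * dirDeriv v ψ x + ψ x * dirDeriv v φ x := by
  simp [dirDeriv, fderiv_fun_mul hφ hψ]

theorem dirDeriv_add (hφ : DifferentiableAt ℝ φ x) (hψ : DifferentiableAt ℝ ψ x) :
    dirDeriv v (fun y => φ y + ψ y) x = dirDeriv v φ x + dirDeriv v ψ x := by
  simp [dirDeriv, fderiv_fun_add hφ hψ]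

theorem continuousAt_lap (h : ContDiffAt ℝ 2 φ x) : ContinuousAt (lap φ) x := by
  have : ∀ i, ContinuousAt (dirDeriv (stdVec i) (dirDeriv (stdVec i) φ)) x := fun i =>
    (contDiffAt_dirDeriv (n := 1) (m := 0) (contDiffAt_dirDeriv (n := 2) (m := 1) h (by norm_num))
      (by norm_num)).continuousAt
  exact tendsto_finsetSum _ fun i _ => this i

theorem lap_mul (hφ : ContDiffAt ℝ 2 φ x) (hψ : ContDiffAt ℝ 2 ψ x) :
    lap (fun y => φ y * ψ y) x = ψ x * lap φ x + 2 * gradDot φ ψ x + φ x * lap ψ x := by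
  have h1 : ∀ {χ : EuclideanSpace ℝ (Fin N) → ℝ}, ContDiffAt ℝ 2 χ x →
      ∀ᶠ y in 𝓝 x, DifferentiableAt ℝ χ y := fun h => by
    filter_upwards [h.eventually (by norm_num)] with y hy
    exact hy.differentiableAt (by norm_num)
  have h2 : ∀ {χ : EuclideanSpace ℝ (Fin N) → ℝ}, ContDiffAt ℝ 2 χ x →
      ∀ v, DifferentiableAt ℝ (dirDeriv v χ) x := fun h v =>
    (contDiffAt_dirDeriv (n := 2) (m := 1) h (by norm_num)).differentiableAt (by norm_num)
  simp only [lap, gradDot, Finset.mul_sum, ← Finset.sum_add_distrib]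
  refine Finset.sum_congr rfl fun i _ => ?_
  have h3 : dirDeriv (stdVec i) (fun y => φ y * ψ y) =ᶠ[𝓝 x]
      fun y => φ y * dirDeriv (stdVec i) ψ y + ψ y * dirDeriv (stdVec i) φ y := by
    filter_upwards [h1 hφ, h1 hψ] with y hy1 hy2 using dirDeriv_mul hy1 hy2
  have d1 := (h1 hφ).self_of_nhds
  have d2 := (h1 hψ).self_of_nhds
  rw [(dirDeriv_congr h3).eq_of_nhds,
    dirDeriv_add (d1.fun_mul (h2 hψ _)) (d2.fun_mul (h2 hφ _)),
    dirDeriv_mul d1 (h2 hψ _), dirDeriv_mul d2 (h2 hφ _)]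
  ring

theorem dirDeriv_radial {F : ℝ → ℝ} {F' : ℝ} (hF : HasDerivAt F F' (‖x‖ ^ 2)) (i : Fin N) :
    dirDeriv (stdVec i) (fun y => F (‖y‖ ^ 2)) x = F' * (2 * x i) := by
  have h := (hF.comp_hasFDerivAt x (hasStrictFDerivAt_norm_sq x).hasFDerivAt).fderiv
  have h' : (fun y => F (‖y‖ ^ 2)) = F ∘ fun y : EuclideanSpace ℝ (Fin N) => ‖y‖ ^ 2 := rfl
  rw [dirDeriv, h', h]
  simp [EuclideanSpace.inner_single_right]

theorem dirDeriv_coord (i : Fin N) :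
    dirDeriv (stdVec i) (fun y => 2 * y i) x = 2 := by
  have h : HasFDerivAt (fun y : EuclideanSpace ℝ (Fin N) => 2 * y i)
      ((2 : ℝ) • (EuclideanSpace.proj i : EuclideanSpace ℝ (Fin N) →L[ℝ] ℝ)) x :=
    (EuclideanSpace.proj i : EuclideanSpace ℝ (Fin N) →L[ℝ] ℝ).hasFDerivAt.const_mul 2
  rw [dirDeriv, h.fderiv]
  simp

theorem sum_sq_coord : ∑ i, x i ^ 2 = ‖x‖ ^ 2 := by
  simp [EuclideanSpace.norm_sq_eq]

/-- The first derivative of `F` has to be known on a neighbourhood before differentiating again,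
whereas `F''` enters only at the point. Using `‖x‖ ^ 2` as radial variable keeps the inner function
polynomial. -/
theorem lap_radial {F F' : ℝ → ℝ} {F'' : ℝ} (hx : x ≠ 0)
    (hF : ∀ s, 0 < s → HasDerivAt F (F' s) s) (hF' : HasDerivAt F' F'' (‖x‖ ^ 2)) :
    lap (fun y => F (‖y‖ ^ 2)) x = 4 * ‖x‖ ^ 2 * F'' + 2 * N * F' (‖x‖ ^ 2) := by
  have key : ∀ i, dirDeriv (stdVec i) (dirDeriv (stdVec i) (fun y => F (‖y‖ ^ 2))) x =
      4 * F'' * x i ^ 2 + 2 * F' (‖x‖ ^ 2) := by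
    intro i
    have h : dirDeriv (stdVec i) (fun y => F (‖y‖ ^ 2)) =ᶠ[𝓝 x]
        fun y => F' (‖y‖ ^ 2) * (2 * y i) := by
      filter_upwards [isOpen_ne.mem_nhds hx] with y hy
      exact dirDeriv_radial (hF _ (by positivity [norm_pos_iff.2 hy])) i
    rw [(dirDeriv_congr h).eq_of_nhds, dirDeriv_mul, dirDeriv_radial hF', dirDeriv_coord]
    · ring
    · exact (hF'.comp_hasFDerivAt x (hasStrictFDerivAt_norm_sq x).hasFDerivAt).differentiableAt
    · exact ((EuclideanSpace.proj i : EuclideanSpace ℝ (Fin N) →L[ℝ] ℝ).differentiableAt.const_mul 2)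
  simp only [lap, key, Finset.sum_add_distrib, ← Finset.mul_sum, sum_sq_coord]
  simp
  ring

theorem gradDot_radial {F G : ℝ → ℝ} {F' G' : ℝ} (hF : HasDerivAt F F' (‖x‖ ^ 2))
    (hG : HasDerivAt G G' (‖x‖ ^ 2)) :
    gradDot (fun y => F (‖y‖ ^ 2)) (fun y => G (‖y‖ ^ 2)) x = 4 * ‖x‖ ^ 2 * F' * G' := by
  simp only [gradDot, dirDeriv_radial hF, dirDeriv_radial hG, ← sum_sq_coord (x := x),
    Finset.mul_sum, Finset.sum_mul]
  exact Finset.sum_congr rfl fun i _ => by ring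

/-- The gradient of a radial function points along `x`. The factor `fderiv ℝ φ x x` is at most
`‖fderiv ℝ φ x‖ * ‖x‖`, which later saves one power of `‖x‖`. -/
theorem gradDot_radial_right {G : ℝ → ℝ} {G' : ℝ} (hG : HasDerivAt G G' (‖x‖ ^ 2)) :
    gradDot φ (fun y => G (‖y‖ ^ 2)) x = 2 * G' * fderiv ℝ φ x x := by
  have hx : x = ∑ i, x i • stdVec i := by
    have := (EuclideanSpace.basisFun (Fin N) ℝ).sum_repr x
    simpa using this.symm
  conv_rhs => rw [hx]
  simp only [gradDot, dirDeriv_radial hG, map_sum, map_smul, Finset.mul_sum, smul_eq_mul]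
  refine Finset.sum_congr rfl fun i _ => ?_
  rw [← hx, dirDeriv]
  ring

end Calculus

/-! ### The distributional Laplacian transferred to test functions. -/

section WeakForm

variable {N : ℕ} {Ω : Opens (EuclideanSpace ℝ (Fin N))}

theorem lineDerivOp_testFunction_apply (v : EuclideanSpace ℝ (Fin N)) (φ : 𝓓(Ω, ℝ)) :
    ⇑(LineDeriv.lineDerivOp v φ) = dirDeriv v φ := by
  funext x
  have h : (LineDeriv.lineDerivOp v φ : 𝓓(Ω, ℝ)) x = TestFunction.fderivCLM ℝ ⊤ ⊤ φ x v := rfl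
  rw [h, TestFunction.fderivCLM_apply_of_le _ (by simp)]
  rfl

/-- The negative Laplacian of a test function, as a test function. -/
noncomputable def testNegLap (φ : 𝓓(Ω, ℝ)) : 𝓓(Ω, ℝ) :=
  -∑ i : Fin N, LineDeriv.lineDerivOp (stdVec i) (LineDeriv.lineDerivOp (stdVec i) φ)

theorem testNegLap_apply (φ : 𝓓(Ω, ℝ)) (x : EuclideanSpace ℝ (Fin N)) :
    testNegLap φ x = - lap φ x := by
  simp [testNegLap, lap, lineDerivOp_testFunction_apply]

theorem negLaplacian_apply (T : 𝓓'(Ω, ℝ)) (φ : 𝓓(Ω, ℝ)) :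
    negLaplacian Ω T φ = T (testNegLap φ) := by
  have h1 : negLaplacian Ω T φ =
      -(LineDeriv.laplacianCLM ℝ (EuclideanSpace ℝ (Fin N)) 𝓓'(Ω, ℝ) T) φ := rfl
  rw [h1, LineDeriv.laplacianCLM_eq_sum (EuclideanSpace.basisFun (Fin N) ℝ), testNegLap, map_neg,
    map_sum]
  simp

theorem distOf_apply {f : EuclideanSpace ℝ (Fin N) → ℝ} (hf : LocallyIntegrableOn f Ω)
    (φ : 𝓓(Ω, ℝ)) : distOf Ω f φ = ∫ x, φ x * f x :=
  TestFunction.integralAgainstBilinCLM_eq_integral hf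

end WeakForm

/-! ### The convex profile and its composition with the logarithm. -/

section Profile

/-- A smooth, nondecreasing, convex function on the line which vanishes exactly on `(-∞, 0]`. -/
noncomputable def convexProfile (t : ℝ) : ℝ := t * expNegInvGlue t

/-- The derivative of `convexProfile`. -/
noncomputable def convexProfileDeriv (t : ℝ) : ℝ := (1 + t⁻¹) * expNegInvGlue t

/-- The second derivative of `convexProfile`. -/
noncomputable def convexProfileDeriv₂ (t : ℝ) : ℝ := t⁻¹ ^ 3 * expNegInvGlue t

theorem expNegInvGlue_hasDerivAt (t : ℝ) :
    HasDerivAt expNegInvGlue (t⁻¹ ^ 2 * expNegInvGlue t) t := by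
  simpa using expNegInvGlue.hasDerivAt_polynomial_eval_inv_mul 1 t

theorem convexProfile_hasDerivAt (t : ℝ) :
    HasDerivAt convexProfile (convexProfileDeriv t) t := by
  refine ((hasDerivAt_id t).mul (expNegInvGlue_hasDerivAt t)).congr_deriv ?_
  rcases eq_or_ne t 0 with rfl | ht
  · simp [convexProfileDeriv]
  · simp only [convexProfileDeriv, id]
    field_simp

/-- Differentiating `p(t⁻¹) * expNegInvGlue t` replaces `p` by `X²(p - p')`; for `p = 1 + X` this is
`X³`, whence convexity. The point `t = 0` is covered by the same formula. -/
theorem convexProfileDeriv_hasDerivAt (t : ℝ) :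
    HasDerivAt convexProfileDeriv (convexProfileDeriv₂ t) t := by
  have h := expNegInvGlue.hasDerivAt_polynomial_eval_inv_mul (1 + Polynomial.X) t
  simp only [Polynomial.eval_add, Polynomial.eval_one, Polynomial.eval_X, Polynomial.derivative_add,
    Polynomial.derivative_one, Polynomial.derivative_X, zero_add, Polynomial.eval_mul,
    Polynomial.eval_pow, add_sub_cancel_left] at h
  refine h.congr_deriv ?_
  simp only [convexProfileDeriv₂]
  ring

theorem contDiff_convexProfile : ContDiff ℝ ∞ convexProfile :=
  contDiff_id.mul (expNegInvGlue.contDiff (n := ⊤))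

theorem continuous_convexProfileDeriv₂ : Continuous convexProfileDeriv₂ := by
  have h := expNegInvGlue.continuous_polynomial_eval_inv_mul (Polynomial.X ^ 3)
  simp only [Polynomial.eval_pow, Polynomial.eval_X] at h
  exact h

theorem convexProfile_of_nonpos {t : ℝ} (ht : t ≤ 0) : convexProfile t = 0 := by
  simp [convexProfile, expNegInvGlue.zero_of_nonpos ht]

theorem convexProfileDeriv_of_nonpos {t : ℝ} (ht : t ≤ 0) : convexProfileDeriv t = 0 := by
  simp [convexProfileDeriv, expNegInvGlue.zero_of_nonpos ht]

theorem convexProfileDeriv₂_of_nonpos {t : ℝ} (ht : t ≤ 0) : convexProfileDeriv₂ t = 0 := by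
  simp [convexProfileDeriv₂, expNegInvGlue.zero_of_nonpos ht]

theorem convexProfile_nonneg (t : ℝ) : 0 ≤ convexProfile t := by
  rcases le_total t 0 with ht | ht
  · rw [convexProfile_of_nonpos ht]
  · exact mul_nonneg ht (expNegInvGlue.nonneg t)

theorem convexProfileDeriv_nonneg (t : ℝ) : 0 ≤ convexProfileDeriv t := by
  rcases le_total t 0 with ht | ht
  · rw [convexProfileDeriv_of_nonpos ht]
  · exact mul_nonneg (by positivity) (expNegInvGlue.nonneg t)

theorem convexProfileDeriv₂_nonneg (t : ℝ) : 0 ≤ convexProfileDeriv₂ t := by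
  rcases le_total t 0 with ht | ht
  · rw [convexProfileDeriv₂_of_nonpos ht]
  · exact mul_nonneg (by positivity) (expNegInvGlue.nonneg t)

theorem convexProfile_one_pos : 0 < convexProfile 1 := by
  rw [convexProfile, one_mul]
  exact expNegInvGlue.pos_of_pos one_pos

theorem exists_bound_of_eq_zero_of_nonpos {f : ℝ → ℝ} (hf : Continuous f)
    (h0 : ∀ t ≤ 0, f t = 0) (M : ℝ) : ∃ B, ∀ t ≤ M, |f t| ≤ B := by
  obtain ⟨B, hB⟩ := (isCompact_Icc (a := 0) (b := M)).exists_bound_of_continuousOn hf.continuousOn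
  refine ⟨max B 0, fun t ht => ?_⟩
  rcases le_total t 0 with h | h
  · simp [h0 t h]
  · exact (hB t ⟨h, ht⟩).trans (le_max_left _ _)

theorem exists_convexProfile_bound (M : ℝ) : ∃ B, 0 ≤ B ∧ ∀ t ≤ M,
    convexProfile t ≤ B ∧ convexProfileDeriv t ≤ B ∧ convexProfileDeriv₂ t ≤ B := by
  obtain ⟨B₀, h₀⟩ := exists_bound_of_eq_zero_of_nonpos contDiff_convexProfile.continuous
    (fun t => convexProfile_of_nonpos) M
  obtain ⟨B₁, h₁⟩ := exists_bound_of_eq_zero_of_nonpos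
    (continuous_iff_continuousAt.2 fun t => (convexProfileDeriv_hasDerivAt t).continuousAt)
    (fun t => convexProfileDeriv_of_nonpos) M
  obtain ⟨B₂, h₂⟩ := exists_bound_of_eq_zero_of_nonpos continuous_convexProfileDeriv₂
    (fun t => convexProfileDeriv₂_of_nonpos) M
  have a₀ := (abs_nonneg _).trans (h₀ M le_rfl)
  have a₁ := (abs_nonneg _).trans (h₁ M le_rfl)
  have a₂ := (abs_nonneg _).trans (h₂ M le_rfl)
  refine ⟨B₀ + B₁ + B₂, by positivity, fun t ht => ⟨?_, ?_, ?_⟩⟩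
  · linarith [(le_abs_self _).trans (h₀ t ht)]
  · linarith [(le_abs_self _).trans (h₁ t ht)]
  · linarith [(le_abs_self _).trans (h₂ t ht)]

/-- The logarithmic variable `1 + log s / (n + 1)`. -/
noncomputable def logVar (n : ℕ) (s : ℝ) : ℝ := 1 + Real.log s / (n + 1)

theorem hasDerivAt_logVar (n : ℕ) {s : ℝ} (hs : 0 < s) :
    HasDerivAt (logVar n) ((n + 1 : ℝ)⁻¹ * s⁻¹) s := by
  have h := ((Real.hasDerivAt_log hs.ne').div_const ((n : ℝ) + 1)).const_add 1
  exact h.congr_deriv (by field_simp)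

/-- `convexProfile (1 + log s / (n + 1))`, extended by zero. -/
noncomputable def logProfile (n : ℕ) (s : ℝ) : ℝ :=
  if s ≤ 0 then 0 else convexProfile (logVar n s)

/-- The derivative of `logProfile` on `(0, ∞)`. -/
noncomputable def logProfileDeriv (n : ℕ) (s : ℝ) : ℝ :=
  convexProfileDeriv (logVar n s) * ((n + 1 : ℝ)⁻¹ * s⁻¹)

theorem logProfile_of_pos (n : ℕ) {s : ℝ} (hs : 0 < s) :
    logProfile n s = convexProfile (logVar n s) := if_neg hs.not_ge

theorem logProfile_hasDerivAt (n : ℕ) {s : ℝ} (hs : 0 < s) :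
    HasDerivAt (logProfile n) (logProfileDeriv n s) s := by
  refine ((convexProfile_hasDerivAt _).comp s (hasDerivAt_logVar n hs)).congr_of_eventuallyEq ?_
  filter_upwards [lt_mem_nhds hs] with t ht using logProfile_of_pos n ht

theorem logProfileDeriv_hasDerivAt (n : ℕ) {s : ℝ} (hs : 0 < s) :
    HasDerivAt (logProfileDeriv n)
      (convexProfileDeriv₂ (logVar n s) * ((n + 1 : ℝ)⁻¹ * s⁻¹) ^ 2 -
        convexProfileDeriv (logVar n s) * ((n + 1 : ℝ)⁻¹ * (s ^ 2)⁻¹)) s := by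
  have h1 := (convexProfileDeriv_hasDerivAt _).comp s (hasDerivAt_logVar n hs)
  have h2 := (hasDerivAt_inv hs.ne').const_mul ((n + 1 : ℝ)⁻¹)
  refine (h1.mul h2).congr_deriv ?_
  simp only [Function.comp]
  ring

/-- The threshold is where `logVar n` reaches `0`. For `s ≤ 0` the explicit zero in `logProfile` is
needed: `Real.log 0 = 0` would give `convexProfile 1`. -/
theorem logProfile_eq_zero (n : ℕ) {s : ℝ} (hs : s ≤ Real.exp (-(n + 1))) : logProfile n s = 0 := by
  by_cases h : s ≤ 0
  · exact if_pos h
  · rw [logProfile_of_pos n (not_le.1 h)]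
    apply convexProfile_of_nonpos
    have h1 : Real.log s ≤ -(n + 1) := (Real.log_le_iff_le_exp (not_le.1 h)).2 hs
    have h2 : Real.log s / (n + 1) ≤ -1 := by
      rw [div_le_iff₀ (by positivity)]
      linarith
    rw [logVar]
    linarith

theorem contDiff_logProfile (n : ℕ) : ContDiff ℝ ∞ (logProfile n) := by
  rw [contDiff_iff_contDiffAt]
  intro s
  rcases le_or_gt s 0 with hs | hs
  · refine (contDiffAt_const (c := (0 : ℝ))).congr_of_eventuallyEq ?_
    filter_upwards [gt_mem_nhds (hs.trans_lt (Real.exp_pos (-((n : ℝ) + 1))))] with t ht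
      using logProfile_eq_zero n ht.le
  · have h : ContDiffAt ℝ ∞ (fun t => convexProfile (logVar n t)) s := by
      refine contDiff_convexProfile.contDiffAt.comp s ?_
      exact contDiffAt_const.add ((Real.contDiffAt_log.2 hs.ne').div_const _)
    refine h.congr_of_eventuallyEq ?_
    filter_upwards [lt_mem_nhds hs] with t ht using logProfile_of_pos n ht

theorem logProfile_nonneg (n : ℕ) (s : ℝ) : 0 ≤ logProfile n s := by
  rw [logProfile]
  split_ifs
  exacts [le_rfl, convexProfile_nonneg _]

theorem logProfileDeriv_nonneg (n : ℕ) {s : ℝ} (hs : 0 < s) : 0 ≤ logProfileDeriv n s :=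
  mul_nonneg (convexProfileDeriv_nonneg _) (by positivity)

theorem logVar_le (n : ℕ) {s S : ℝ} (hs : 0 < s) (h : s ≤ S) : logVar n s ≤ 1 + |Real.log S| := by
  have h1 : Real.log s ≤ |Real.log S| := (Real.log_le_log hs h).trans (le_abs_self _)
  have h2 : Real.log s / (n + 1) ≤ |Real.log S| := by
    rw [div_le_iff₀ (by positivity)]
    nlinarith [abs_nonneg (Real.log S), (Nat.cast_nonneg n : (0 : ℝ) ≤ n)]
  rw [logVar]
  linarith

theorem tendsto_logProfile {s : ℝ} (hs : 0 < s) :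
    Tendsto (fun n => logProfile n s) atTop (𝓝 (convexProfile 1)) := by
  have h : Tendsto (fun n => logVar n s) atTop (𝓝 1) := by
    have := (tendsto_one_div_add_atTop_nhds_zero_nat (𝕜 := ℝ)).const_mul (Real.log s)
    simpa [logVar, div_eq_mul_inv] using this.const_add 1
  simp only [logProfile_of_pos _ hs]
  exact (contDiff_convexProfile.continuous.tendsto 1).comp h

end Profile

/-! ### Subharmonic logarithmic cut-offs and their uniform bounds. -/

section LogCutoff

variable {N : ℕ}

/-- The logarithmic cut-off of the origin, `convexProfile (1 + log ‖x‖² / (n + 1))`. -/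
noncomputable def logCutoff (n : ℕ) (x : EuclideanSpace ℝ (Fin N)) : ℝ := logProfile n (‖x‖ ^ 2)

variable {x : EuclideanSpace ℝ (Fin N)}

theorem contDiff_logCutoff (n : ℕ) :
    ContDiff ℝ ∞ (logCutoff n : EuclideanSpace ℝ (Fin N) → ℝ) :=
  (contDiff_logProfile n).comp (contDiff_norm_sq ℝ)

theorem logCutoff_nonneg (n : ℕ) (x : EuclideanSpace ℝ (Fin N)) : 0 ≤ logCutoff n x :=
  logProfile_nonneg n _

theorem logCutoff_eventually_zero (n : ℕ) :
    ∀ᶠ x : EuclideanSpace ℝ (Fin N) in 𝓝 0, logCutoff n x = 0 := by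
  have h : ContinuousAt (fun x : EuclideanSpace ℝ (Fin N) => ‖x‖ ^ 2) 0 := by fun_prop
  have h' : ∀ᶠ x : EuclideanSpace ℝ (Fin N) in 𝓝 0, ‖x‖ ^ 2 < Real.exp (-((n : ℝ) + 1)) :=
    h.eventually (gt_mem_nhds (by simpa using Real.exp_pos _))
  filter_upwards [h'] with x hx using logProfile_eq_zero n hx.le

theorem tendsto_logCutoff (hx : x ≠ 0) :
    Tendsto (fun n => logCutoff n x) atTop (𝓝 (convexProfile 1)) :=
  tendsto_logProfile (by have := norm_pos_iff.2 hx; positivity)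

/-- The `-4` comes from the second derivative of the logarithm; the factor `2 * N - 4` vanishes for
`N = 2`, where `log ‖x‖` is harmonic. -/
theorem lap_logCutoff (n : ℕ) (hx : x ≠ 0) :
    lap (logCutoff n) x = (4 * convexProfileDeriv₂ (logVar n (‖x‖ ^ 2)) * (n + 1 : ℝ)⁻¹ +
      (2 * N - 4) * convexProfileDeriv (logVar n (‖x‖ ^ 2))) * ((n + 1 : ℝ)⁻¹ * (‖x‖ ^ 2)⁻¹) := by
  have hx' := norm_pos_iff.2 hx
  have hs : 0 < ‖x‖ ^ 2 := by positivity
  have h := lap_radial hx (fun s hs => logProfile_hasDerivAt n hs) (logProfileDeriv_hasDerivAt n hs)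
  refine Eq.trans h ?_
  rw [logProfileDeriv]
  field_simp
  ring

theorem lap_logCutoff_nonneg (hN : 2 ≤ N) (n : ℕ) (hx : x ≠ 0) : 0 ≤ lap (logCutoff n) x := by
  rw [lap_logCutoff n hx]
  have h2 : (2 : ℝ) ≤ N := by exact_mod_cast hN
  have h1 := convexProfileDeriv_nonneg (logVar n (‖x‖ ^ 2))
  have h0 := convexProfileDeriv₂_nonneg (logVar n (‖x‖ ^ 2))
  have h3 : (0 : ℝ) ≤ 2 * N - 4 := by linarith
  positivity

theorem gradDot_logCutoff (φ : EuclideanSpace ℝ (Fin N) → ℝ) (n : ℕ) (hx : x ≠ 0) :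
    gradDot φ (logCutoff n) x = 2 * logProfileDeriv n (‖x‖ ^ 2) * fderiv ℝ φ x x :=
  gradDot_radial_right (logProfile_hasDerivAt n (by have := norm_pos_iff.2 hx; positivity))

/-- The logarithmic cut-offs are bounded on bounded sets, with a gradient of order
`1 / ((n + 1) ‖x‖)` and a Laplacian of order `1 / ((n + 1) ‖x‖ ^ 2)`. -/
theorem exists_logCutoff_bound (hN : 2 ≤ N) (R : ℝ) : ∃ B, 0 ≤ B ∧
    ∀ x : EuclideanSpace ℝ (Fin N), ‖x‖ ≤ R → ∀ n : ℕ, logCutoff n x ≤ B ∧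
      (x ≠ 0 → (∀ φ : EuclideanSpace ℝ (Fin N) → ℝ, |gradDot φ (logCutoff n) x| ≤
        B * ‖fderiv ℝ φ x‖ * ((n + 1 : ℝ)⁻¹ * ‖x‖⁻¹)) ∧
      lap (logCutoff n) x ≤ B * ((n + 1 : ℝ)⁻¹ * (‖x‖ ^ 2)⁻¹)) := by
  obtain ⟨B, hB0, hB⟩ := exists_convexProfile_bound (1 + |Real.log (R ^ 2)|)
  have h2 : (2 : ℝ) ≤ N := by exact_mod_cast hN
  -- The Laplacian dictates the constant, `4 * B + (2 * N - 4) * B`; the value needs only `B` and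
  -- the gradient only `2 * B`.
  refine ⟨(2 * N) * B, by positivity, fun x hxR n => ?_⟩
  rcases eq_or_ne x 0 with rfl | hx
  · rw [(logCutoff_eventually_zero n).self_of_nhds]
    exact ⟨by positivity, fun h => (h rfl).elim⟩
  have hx' := norm_pos_iff.2 hx
  have hs : 0 < ‖x‖ ^ 2 := by positivity
  obtain ⟨b0, b1, b2⟩ := hB _ (logVar_le n hs (pow_le_pow_left₀ hx'.le hxR 2))
  have p1 := convexProfileDeriv_nonneg (logVar n (‖x‖ ^ 2))
  have p2 := convexProfileDeriv₂_nonneg (logVar n (‖x‖ ^ 2))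
  refine ⟨?_, fun _ => ⟨fun φ => ?_, ?_⟩⟩
  · rw [logCutoff, logProfile_of_pos n hs]
    nlinarith
  · rw [gradDot_logCutoff φ n hx, abs_mul, abs_of_nonneg
      (mul_nonneg zero_le_two (logProfileDeriv_nonneg n hs)), logProfileDeriv]
    have hD : |fderiv ℝ φ x x| ≤ ‖fderiv ℝ φ x‖ * ‖x‖ := (fderiv ℝ φ x).le_opNorm x
    calc _ ≤ 2 * (B * ((n + 1 : ℝ)⁻¹ * (‖x‖ ^ 2)⁻¹)) * (‖fderiv ℝ φ x‖ * ‖x‖) := by gcongr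
      _ = 2 * B * ‖fderiv ℝ φ x‖ * ((n + 1 : ℝ)⁻¹ * ‖x‖⁻¹) := by field_simp
      _ ≤ _ := by gcongr; nlinarith
  · rw [lap_logCutoff n hx]
    have hn : (n + 1 : ℝ)⁻¹ ≤ 1 := inv_le_one_of_one_le₀ (by linarith [(Nat.cast_nonneg n : (0 : ℝ) ≤ n)])
    have h3 : (0 : ℝ) ≤ 2 * N - 4 := by linarith
    gcongr
    calc _ ≤ 4 * B * 1 + (2 * N - 4) * B := by gcongr
      _ = _ := by ring

end LogCutoff

/-! ### Integrability near the origin. -/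

section Punctured

variable {N : ℕ} {Ω : Opens (EuclideanSpace ℝ (Fin N))} {u f φ : EuclideanSpace ℝ (Fin N) → ℝ}

theorem integrable_testFunction_mul (hf : LocallyIntegrableOn f Ω) (φ : 𝓓(Ω, ℝ)) :
    Integrable (fun x => φ x * f x) :=
  TestFunction.integrable_bilin (ContinuousLinearMap.mul ℝ ℝ) hf φ

theorem integrable_lap_mul (hf : LocallyIntegrableOn f Ω) (φ : 𝓓(Ω, ℝ)) :
    Integrable (fun x => lap φ x * f x) := by
  have h := (integrable_testFunction_mul hf (testNegLap φ)).neg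
  refine h.congr (Eventually.of_forall fun x => ?_)
  simp [testNegLap_apply]

theorem negLaplacian_distOf_apply (hu : LocallyIntegrableOn u Ω) (φ : 𝓓(Ω, ℝ)) :
    negLaplacian Ω (distOf Ω u) φ = - ∫ x, lap φ x * u x := by
  rw [negLaplacian_apply, distOf_apply hu, ← integral_neg]
  simp [testNegLap_apply]

/-- The product of a function smooth off the origin with a logarithmic cut-off is a test function
on the punctured set. -/
theorem exists_testFunction_logCutoff (hφ : ∀ x ≠ 0, ContDiffAt ℝ ∞ φ x)
    (hc : HasCompactSupport φ) (hs : tsupport φ ⊆ Ω) (n : ℕ) :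
    ∃ χ : 𝓓(punctured Ω, ℝ), ∀ x, χ x = φ x * logCutoff n x := by
  have hz : ∀ᶠ x : EuclideanSpace ℝ (Fin N) in 𝓝 0, φ x * logCutoff n x = 0 := by
    filter_upwards [logCutoff_eventually_zero n] with x hx
    rw [hx, mul_zero]
  refine ⟨⟨fun x => φ x * logCutoff n x, ?_, hc.mul_right, ?_⟩, fun x => rfl⟩
  · refine contDiff_iff_contDiffAt.2 fun x => ?_
    rcases eq_or_ne x 0 with rfl | hx
    · exact (contDiffAt_const (c := (0 : ℝ))).congr_of_eventuallyEq hz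
    · exact (hφ x hx).mul (contDiff_logCutoff n).contDiffAt
  · refine fun x hx => ⟨hs (tsupport_mul_subset_left hx), ?_⟩
    rintro rfl
    exact (notMem_tsupport_iff_eventuallyEq.2 hz) hx

theorem lap_mul_logCutoff (hφ : ∀ x ≠ 0, ContDiffAt ℝ ∞ φ x) (n : ℕ)
    {x : EuclideanSpace ℝ (Fin N)} (hx : x ≠ 0) :
    lap (fun y => φ y * logCutoff n y) x =
      logCutoff n x * lap φ x + 2 * gradDot φ (logCutoff n) x + φ x * lap (logCutoff n) x :=
  lap_mul ((hφ x hx).of_le ENat.LEInfty.out)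
    ((contDiff_logCutoff n).contDiffAt.of_le ENat.LEInfty.out)

theorem ae_ne_zero (hN : 2 ≤ N) : ∀ᵐ x : EuclideanSpace ℝ (Fin N), x ≠ 0 := by
  have : Nonempty (Fin N) := ⟨⟨0, by omega⟩⟩
  exact compl_mem_ae_iff.2 (measure_singleton 0)

theorem ae_of_ae_restrict_punctured (hN : 2 ≤ N) {p : EuclideanSpace ℝ (Fin N) → Prop}
    (h : ∀ᵐ x ∂volume.restrict (punctured Ω : Set (EuclideanSpace ℝ (Fin N))), p x) :
    ∀ᵐ x : EuclideanSpace ℝ (Fin N), x ∈ Ω → p x := by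
  filter_upwards [(ae_restrict_iff' (punctured Ω).isOpen.measurableSet).1 h, ae_ne_zero hN]
    with x hx hx0 hxΩ using hx ⟨hxΩ, hx0⟩

/-- In the weight `1 + ‖x‖` the constant controls `f`, while the positive Laplacian of the norm
controls `u / ‖x‖`. The square root of `‖y‖ ^ 2` puts the norm in the form required by `lap_radial`.
-/
theorem lap_one_add_norm {x : EuclideanSpace ℝ (Fin N)} (hx : x ≠ 0) :
    lap (fun y => 1 + √(‖y‖ ^ 2)) x = (N - 1) * ‖x‖⁻¹ := by
  have hx' := norm_pos_iff.2 hx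
  have h1 : ∀ s : ℝ, 0 < s → HasDerivAt (fun s => 1 + √s) (2 * √s)⁻¹ s := fun s hs =>
    ((Real.hasDerivAt_sqrt hs.ne').const_add 1).congr_deriv (one_div _)
  have h2 : HasDerivAt (fun s => (2 * √s)⁻¹) (-(1 / (4 * ‖x‖ ^ 3))) (‖x‖ ^ 2) := by
    have hs : ‖x‖ ^ 2 ≠ 0 := by positivity
    refine (((Real.hasDerivAt_sqrt hs).const_mul 2).inv (by positivity)).congr_deriv ?_
    rw [Real.sqrt_sq hx'.le]
    field_simp
    norm_num
  rw [lap_radial hx h1 h2, Real.sqrt_sq hx'.le]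
  field_simp
  ring

theorem gradDot_one_add_norm_nonneg (n : ℕ) {x : EuclideanSpace ℝ (Fin N)} (hx : x ≠ 0) :
    0 ≤ gradDot (fun y => 1 + √(‖y‖ ^ 2)) (logCutoff n) x := by
  have hs : 0 < ‖x‖ ^ 2 := by have := norm_pos_iff.2 hx; positivity
  have h := gradDot_radial ((Real.hasDerivAt_sqrt hs.ne').const_add 1) (logProfile_hasDerivAt n hs)
  have h' : 0 ≤ 4 * ‖x‖ ^ 2 * (1 / (2 * √(‖x‖ ^ 2))) * logProfileDeriv n (‖x‖ ^ 2) :=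
    mul_nonneg (by positivity) (logProfileDeriv_nonneg n hs)
  exact h'.trans_eq h.symm

/-- On compact sets avoiding the origin, multiplication by the logarithmic cut-offs
gives uniformly bounded Laplacians. -/
theorem exists_lap_mul_logCutoff_bound (hN : 2 ≤ N) (hφ : ∀ x ≠ 0, ContDiffAt ℝ ∞ φ x)
    {A : Set (EuclideanSpace ℝ (Fin N))} (hA : IsCompact A) {r : ℝ} (hr : 0 < r)
    (hAr : ∀ x ∈ A, r ≤ ‖x‖) :
    ∃ C, 0 ≤ C ∧ ∀ x ∈ A, ∀ n : ℕ, |lap (fun y => φ y * logCutoff n y) x| ≤ C := by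
  obtain ⟨R, hR⟩ := hA.isBounded.exists_norm_le
  obtain ⟨B, hB0, hB⟩ := exists_logCutoff_bound hN R
  have h0 : ∀ x ∈ A, x ≠ 0 := fun x hx h => by
    have := hAr x hx
    rw [h, norm_zero] at this
    linarith
  have c0 : ContinuousOn φ A := fun x hx => (hφ x (h0 x hx)).continuousAt.continuousWithinAt
  have c1 : ContinuousOn (fderiv ℝ φ) A := fun x hx =>
    ((hφ x (h0 x hx)).fderiv_right (m := 0) (by norm_num)).continuousAt.continuousWithinAt
  have c2 : ContinuousOn (lap φ) A := fun x hx =>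
    (continuousAt_lap ((hφ x (h0 x hx)).of_le ENat.LEInfty.out)).continuousWithinAt
  obtain ⟨C₀, hC₀⟩ := hA.exists_bound_of_continuousOn c0
  obtain ⟨C₁, hC₁⟩ := hA.exists_bound_of_continuousOn c1
  obtain ⟨C₂, hC₂⟩ := hA.exists_bound_of_continuousOn c2
  -- A point of `A` is what shows that the bounds `C₀`, `C₁`, `C₂` are nonnegative.
  rcases A.eq_empty_or_nonempty with rfl | ⟨a, ha⟩
  · exact ⟨0, le_rfl, by simp⟩
  have p0 := (norm_nonneg _).trans (hC₀ a ha)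
  have p1 := (norm_nonneg _).trans (hC₁ a ha)
  have p2 := (norm_nonneg _).trans (hC₂ a ha)
  -- One summand per term of the product rule; each `1` bounds `(n + 1)⁻¹`.
  refine ⟨B * C₂ + 2 * (B * C₁ * (1 * r⁻¹)) + C₀ * (B * (1 * (r ^ 2)⁻¹)), by positivity,
    fun x hx n => ?_⟩
  have hn : (n + 1 : ℝ)⁻¹ ≤ 1 :=
    inv_le_one_of_one_le₀ (by linarith [(Nat.cast_nonneg n : (0 : ℝ) ≤ n)])
  obtain ⟨b0, b⟩ := hB x (hR x hx) n
  obtain ⟨b1, b2⟩ := b (h0 x hx)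
  have hrx := hAr x hx
  have e1 : |gradDot φ (logCutoff n) x| ≤ B * C₁ * (1 * r⁻¹) := by
    refine (b1 φ).trans ?_
    gcongr
    exact hC₁ x hx
  have e2 : lap (logCutoff n) x ≤ B * (1 * (r ^ 2)⁻¹) := by
    refine b2.trans ?_
    gcongr
  rw [lap_mul_logCutoff hφ n (h0 x hx)]
  refine (abs_add_le _ _).trans (add_le_add ((abs_add_le _ _).trans (add_le_add ?_ ?_)) ?_)
  · rw [abs_mul, abs_of_nonneg (logCutoff_nonneg n x)]
    exact mul_le_mul b0 (hC₂ x hx) (abs_nonneg _) hB0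
  · rw [abs_mul, abs_two]
    gcongr
  · rw [abs_mul, abs_of_nonneg (lap_logCutoff_nonneg hN n (h0 x hx))]
    exact mul_le_mul (hC₀ x hx) e2 (lap_logCutoff_nonneg hN n (h0 x hx)) p0

theorem isCompact_annulus (r R : ℝ) :
    IsCompact (Metric.closedBall (0 : EuclideanSpace ℝ (Fin N)) R \ Metric.ball 0 r) :=
  (isCompact_closedBall _ _).diff Metric.isOpen_ball

/-- A nonnegative weak solution of `-Δ u = f ≥ 0` in a punctured neighbourhood of the origin
satisfies `f ∈ L¹` and `u / ‖x‖ ∈ L¹` near the origin. -/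
theorem exists_integrableOn_ball (hN : 2 ≤ N) (h0 : (0 : EuclideanSpace ℝ (Fin N)) ∈ Ω)
    (hu : LocallyIntegrableOn u (punctured Ω)) (hf : LocallyIntegrableOn f (punctured Ω))
    (hu0 : ∀ᵐ x : EuclideanSpace ℝ (Fin N), x ∈ Ω → 0 ≤ u x)
    (hf0 : ∀ᵐ x : EuclideanSpace ℝ (Fin N), x ∈ Ω → 0 ≤ f x)
    (heq : negLaplacian (punctured Ω) (distOf (punctured Ω) u) = distOf (punctured Ω) f) :
    ∃ r > 0, IntegrableOn f (Metric.ball 0 r) ∧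
      IntegrableOn (fun x => ‖x‖⁻¹ * u x) (Metric.ball 0 r) := by
  obtain ⟨R, hR, hRΩ⟩ := Metric.nhds_basis_closedBall.mem_iff.1 (Ω.isOpen.mem_nhds h0)
  obtain ⟨r, hr, hrR⟩ : ∃ r, 0 < r ∧ r < R := ⟨R / 2, by linarith, by linarith⟩
  let η : ContDiffBump (0 : EuclideanSpace ℝ (Fin N)) := ⟨r, R, hr, hrR⟩
  set φ : EuclideanSpace ℝ (Fin N) → ℝ := fun x => η x * (1 + √(‖x‖ ^ 2)) with hφdef
  have hφnorm : ∀ x, φ x = η x * (1 + ‖x‖) := fun x => by rw [hφdef]; simp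
  have hφnn : ∀ x, 0 ≤ φ x := fun x => by
    rw [hφnorm]
    exact mul_nonneg η.nonneg (by positivity)
  have hφ : ∀ x ≠ 0, ContDiffAt ℝ ∞ φ x := fun x hx =>
    (η.contDiff (n := ⊤)).contDiffAt.mul (contDiffAt_const.add
      (((contDiff_norm_sq ℝ).contDiffAt).sqrt (by have := norm_pos_iff.2 hx; positivity)))
  have hη : tsupport η = Metric.closedBall 0 R := η.tsupport_eq
  have hsub : tsupport φ ⊆ Metric.closedBall 0 R := hη ▸ tsupport_mul_subset_left
  have hc : HasCompactSupport φ := η.hasCompactSupport.mul_right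
  have hnear : ∀ x ∈ Metric.ball (0 : EuclideanSpace ℝ (Fin N)) r,
      φ =ᶠ[𝓝 x] fun y => 1 + √(‖y‖ ^ 2) := fun x hx => by
    filter_upwards [Metric.isOpen_ball.mem_nhds hx] with y hy
    have h1 : η y = 1 := η.one_of_mem_closedBall (Metric.ball_subset_closedBall hy)
    rw [hφdef]
    simp [h1]
  choose χ hχ using exists_testFunction_logCutoff (Ω := Ω) hφ hc (hsub.trans hRΩ)
  have hχ' : ∀ n, ⇑(χ n) = fun x => φ x * logCutoff n x := fun n => funext (hχ n)
  set A := Metric.closedBall (0 : EuclideanSpace ℝ (Fin N)) R \ Metric.ball 0 r with hAdef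
  have hAc : IsCompact A := isCompact_annulus r R
  have hAr : ∀ x ∈ A, r ≤ ‖x‖ := fun x hx => by simpa using hx.2
  obtain ⟨C, hC0, hC⟩ := exists_lap_mul_logCutoff_bound hN hφ hAc hr hAr
  have hAΩ : A ⊆ punctured Ω := fun x hx => ⟨hRΩ hx.1, fun h => by
    have h1 := hAr x hx
    rw [Set.mem_singleton_iff.1 h, norm_zero] at h1
    linarith⟩
  have huA : Integrable (A.indicator u) :=
    (hu.integrableOn_compact_subset hAΩ hAc).integrable_indicator hAc.measurableSet
  -- The bracket integrates to zero by the weak equation. The last term compensates its possible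
  -- negativity on the annulus, so `G n ≥ 0` almost everywhere with an integral independent of `n`.
  set G : ℕ → EuclideanSpace ℝ (Fin N) → ℝ :=
    fun n x => (χ n x * f x + lap (χ n) x * u x) + C * A.indicator u x with hG
  have hGint : ∀ n, Integrable (G n) := fun n =>
    ((integrable_testFunction_mul hf (χ n)).add (integrable_lap_mul hu (χ n))).add
      (huA.const_mul C)
  have hGI : ∀ n, ∫ x, G n x = C * ∫ x, A.indicator u x := fun n => by
    have h1 := congrArg (fun T : 𝓓'(punctured Ω, ℝ) => T (χ n)) heq
    simp only [negLaplacian_distOf_apply hu, distOf_apply hf] at h1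
    have e1 := integral_add ((integrable_testFunction_mul hf (χ n)).add
      (integrable_lap_mul hu (χ n))) (huA.const_mul C)
    have e2 := integral_add (integrable_testFunction_mul hf (χ n)) (integrable_lap_mul hu (χ n))
    have e3 := integral_const_mul (μ := volume) C (A.indicator u)
    simp only [Pi.add_apply] at e1
    simp only [hG]
    linarith
  have hball : ∀ᵐ x : EuclideanSpace ℝ (Fin N), x ∈ Metric.ball (0 : EuclideanSpace ℝ (Fin N)) r →
      0 ≤ u x ∧ 0 ≤ f x ∧ x ≠ 0 ∧ ∀ n, (f x + ‖x‖⁻¹ * u x) * logCutoff n x ≤ G n x := by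
    filter_upwards [hu0, hf0, ae_ne_zero hN] with x hux hfx hx0 hx
    have hxΩ : x ∈ Ω := hRΩ (Metric.ball_subset_closedBall (Metric.ball_subset_ball hrR.le hx))
    have hx' := norm_pos_iff.2 hx0
    specialize hux hxΩ
    specialize hfx hxΩ
    refine ⟨hux, hfx, hx0, fun n => ?_⟩
    have hxA : x ∉ A := fun h => h.2 hx
    have hφx : φ x = 1 + ‖x‖ := by
      rw [(hnear x hx).eq_of_nhds]
      simp
    have hζ := logCutoff_nonneg n x
    simp only [hG, Set.indicator_of_notMem hxA, mul_zero, add_zero]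
    rw [hχ', lap_mul_logCutoff hφ n hx0, lap_congr (hnear x hx), lap_one_add_norm hx0,
      gradDot_congr_left (hnear x hx), hφx]
    have g1 := gradDot_one_add_norm_nonneg n hx0
    have g2 := lap_logCutoff_nonneg hN n hx0
    have g3 : (1 : ℝ) ≤ N - 1 := by
      have : (2 : ℝ) ≤ N := by exact_mod_cast hN
      linarith
    have k1 : f x * logCutoff n x ≤ (1 + ‖x‖) * logCutoff n x * f x := by
      nlinarith [mul_nonneg hx'.le (mul_nonneg hζ hfx)]
    have k2 : ‖x‖⁻¹ * logCutoff n x ≤ logCutoff n x * ((N - 1) * ‖x‖⁻¹) := by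
      have : 0 ≤ ‖x‖⁻¹ * logCutoff n x := by positivity
      nlinarith
    have k3 : 0 ≤ (1 + ‖x‖) * lap (logCutoff n) x := by positivity
    have k4 := mul_le_mul_of_nonneg_right (k2.trans (le_add_of_nonneg_right
      (add_nonneg (mul_nonneg zero_le_two g1) k3))) hux
    rw [← add_assoc] at k4
    beta_reduce
    rw [hφx]
    linarith
  have hGnn : ∀ n, 0 ≤ᵐ[volume] G n := fun n => by
    filter_upwards [hball, hu0, hf0] with x hx hux hfx
    by_cases hxb : x ∈ Metric.ball (0 : EuclideanSpace ℝ (Fin N)) r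
    · obtain ⟨h1, h2, -, h3⟩ := hx hxb
      exact (mul_nonneg (by positivity) (logCutoff_nonneg n x)).trans (h3 n)
    by_cases hxR : x ∈ Metric.closedBall (0 : EuclideanSpace ℝ (Fin N)) R
    · have hxA : x ∈ A := ⟨hxR, hxb⟩
      specialize hux (hRΩ hxR)
      specialize hfx (hRΩ hxR)
      simp only [hG, Set.indicator_of_mem hxA, Pi.zero_apply]
      rw [hχ']
      have k1 : 0 ≤ φ x * logCutoff n x * f x :=
        mul_nonneg (mul_nonneg (hφnn x) (logCutoff_nonneg n x)) hfx
      have k2 := mul_le_mul_of_nonneg_right (neg_le_of_abs_le (hC x hxA n)) hux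
      linarith
    · have hz : χ n =ᶠ[𝓝 x] 0 := by
        filter_upwards [notMem_tsupport_iff_eventuallyEq.1 fun h => hxR (hsub h)] with y hy
        rw [hχ, hy]
        simp
      have hxA : x ∉ A := fun h => hxR h.1
      simp only [hG, Set.indicator_of_notMem hxA, lap_eq_zero hz, hz.eq_of_nhds, Pi.zero_apply]
      simp
  set μ := volume.restrict (Metric.ball (0 : EuclideanSpace ℝ (Fin N)) r) with hμ
  have hballμ := (ae_restrict_iff' (μ := volume)
    (Metric.isOpen_ball (x := (0 : EuclideanSpace ℝ (Fin N))) (ε := r)).measurableSet).2 hball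
  rw [← hμ] at hballμ
  have hae : Metric.ball (0 : EuclideanSpace ℝ (Fin N)) r ≤ᵐ[volume]
      (punctured Ω : Set (EuclideanSpace ℝ (Fin N))) := by
    filter_upwards [ae_ne_zero hN] with x hx0 hx
    exact ⟨hRΩ (Metric.ball_subset_closedBall (Metric.ball_subset_ball hrR.le hx)), hx0⟩
  have hμle : μ ≤ volume.restrict (punctured Ω : Set (EuclideanSpace ℝ (Fin N))) :=
    Measure.restrict_mono' hae le_rfl
  have mf : AEStronglyMeasurable f μ := hf.aestronglyMeasurable.mono_measure hμle
  have mu : AEStronglyMeasurable (fun x => ‖x‖⁻¹ * u x) μ :=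
    (measurable_norm.inv.aestronglyMeasurable).mul (hu.aestronglyMeasurable.mono_measure hμle)
  have hbound : ∀ n, ∫⁻ x, ENNReal.ofReal ((f x + ‖x‖⁻¹ * u x) * logCutoff n x) ∂μ ≤
      ENNReal.ofReal (C * ∫ x, A.indicator u x) := fun n => by
    calc _ ≤ ∫⁻ x, ENNReal.ofReal (G n x) ∂μ := by
          refine lintegral_mono_ae ?_
          filter_upwards [hballμ] with x hx using ENNReal.ofReal_le_ofReal (hx.2.2.2 n)
      _ ≤ ∫⁻ x, ENNReal.ofReal (G n x) := lintegral_mono' Measure.restrict_le_self le_rfl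
      _ = _ := by rw [← ofReal_integral_eq_lintegral_ofReal (hGint n) (hGnn n), hGI n]
  -- Fatou rather than monotone or dominated convergence: only nonnegativity and the uniform bound
  -- `hbound` are available.
  have hfatou : ∫⁻ x, ENNReal.ofReal ((f x + ‖x‖⁻¹ * u x) * convexProfile 1) ∂μ ≤
      ENNReal.ofReal (C * ∫ x, A.indicator u x) := by
    have hm : ∀ n : ℕ, AEMeasurable
        (fun x => ENNReal.ofReal ((f x + ‖x‖⁻¹ * u x) * logCutoff n x)) μ := fun n =>
      ((mf.add mu).mul (contDiff_logCutoff n).continuous.aestronglyMeasurable).aemeasurable.ennreal_ofReal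
    calc _ = ∫⁻ x, liminf (fun n => ENNReal.ofReal ((f x + ‖x‖⁻¹ * u x) * logCutoff n x)) atTop ∂μ := by
          refine lintegral_congr_ae ?_
          filter_upwards [hballμ] with x hx
          exact (((ENNReal.continuous_ofReal.tendsto _).comp
            ((tendsto_logCutoff hx.2.2.1).const_mul _)).liminf_eq).symm
      _ ≤ liminf (fun n => ∫⁻ x, ENNReal.ofReal ((f x + ‖x‖⁻¹ * u x) * logCutoff n x) ∂μ) atTop :=
          lintegral_liminf_le' hm
      _ ≤ _ := liminf_le_of_le (by isBoundedDefault) fun b hb => by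
          obtain ⟨n, hn⟩ := hb.exists
          exact hn.trans (hbound n)
  have hsum : Integrable (fun x => (f x + ‖x‖⁻¹ * u x) * convexProfile 1) μ := by
    refine ⟨(mf.add mu).mul_const _, ?_⟩
    rw [hasFiniteIntegral_iff_ofReal]
    · exact hfatou.trans_lt ENNReal.ofReal_lt_top
    · filter_upwards [hballμ] with x hx
      obtain ⟨h1, h2, -, -⟩ := hx
      exact mul_nonneg (by positivity) convexProfile_one_pos.le
  have hsum' : Integrable (fun x => f x + ‖x‖⁻¹ * u x) μ := by
    have h := hsum.mul_const (convexProfile 1)⁻¹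
    simpa only [mul_inv_cancel_right₀ convexProfile_one_pos.ne'] using h
  refine ⟨r, hr, hsum'.mono' mf ?_, hsum'.mono' mu ?_⟩
  · filter_upwards [hballμ] with x hx
    obtain ⟨h1, h2, -, -⟩ := hx
    rw [Real.norm_of_nonneg h2]
    exact le_add_of_nonneg_right (by positivity)
  · filter_upwards [hballμ] with x hx
    obtain ⟨h1, h2, -, -⟩ := hx
    rw [Real.norm_of_nonneg (by positivity)]
    exact le_add_of_nonneg_left h2

end Punctured

/-! ### The defect at the origin is a nonnegative Dirac mass. -/

section Removable

variable {N : ℕ} {Ω : Opens (EuclideanSpace ℝ (Fin N))} {u f : EuclideanSpace ℝ (Fin N) → ℝ}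

theorem locallyIntegrableOn_of_punctured (hf : LocallyIntegrableOn f (punctured Ω)) {r : ℝ}
    (hr : 0 < r) (hfr : IntegrableOn f (Metric.ball 0 r)) : LocallyIntegrableOn f Ω := by
  intro x hx
  rcases eq_or_ne x 0 with rfl | hx0
  · exact ⟨_, mem_nhdsWithin_of_mem_nhds (Metric.ball_mem_nhds _ hr), hfr⟩
  · have hx' : x ∈ (punctured Ω : Set (EuclideanSpace ℝ (Fin N))) := ⟨hx, hx0⟩
    have h := hf x hx'
    rw [(punctured Ω).isOpen.nhdsWithin_eq hx'] at h
    rwa [Ω.isOpen.nhdsWithin_eq hx]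

theorem locallyIntegrableOn_norm_inv_mul (hu : LocallyIntegrableOn u (punctured Ω)) :
    LocallyIntegrableOn (fun x => ‖x‖⁻¹ * u x) (punctured Ω) := by
  refine hu.continuousOn_mul ?_ (punctured Ω).isOpen.isLocallyClosed
  exact continuous_norm.continuousOn.inv₀ fun x hx => norm_ne_zero_iff.2 hx.2

/-- The defect `-Δ u - f` is recovered from the terms in which the logarithmic cut-offs are
differentiated. -/
theorem tendsto_integral_logCutoff (hN : 2 ≤ N) (hu : LocallyIntegrableOn u Ω)
    (hf : LocallyIntegrableOn f Ω) (hu' : LocallyIntegrableOn u (punctured Ω))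
    (hf' : LocallyIntegrableOn f (punctured Ω))
    (heq : negLaplacian (punctured Ω) (distOf (punctured Ω) u) = distOf (punctured Ω) f)
    (φ : 𝓓(Ω, ℝ)) :
    (∀ n, Integrable fun x =>
      (lap (fun y => φ y * logCutoff n y) x - logCutoff n x * lap φ x) * u x) ∧
    Tendsto (fun n => ∫ x, (lap (fun y => φ y * logCutoff n y) x - logCutoff n x * lap φ x) * u x)
      atTop (𝓝 (convexProfile 1 * (negLaplacian Ω (distOf Ω u) - distOf Ω f) φ)) := by
  choose χ hχ using exists_testFunction_logCutoff (Ω := Ω)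
    (fun x _ => φ.contDiff.contDiffAt) φ.hasCompactSupport φ.tsupport_subset
  have hχ' : ∀ n, ⇑(χ n) = fun x => φ x * logCutoff n x := fun n => funext (hχ n)
  obtain ⟨R, hR⟩ := φ.hasCompactSupport.isCompact.isBounded.exists_norm_le
  obtain ⟨B, hB0, hB⟩ := exists_logCutoff_bound hN R
  -- Dominated convergence: the cut-offs are bounded by `B` on the support of `φ`, uniformly in `n`.
  have key : ∀ {w : EuclideanSpace ℝ (Fin N) → ℝ}, Integrable w → (∀ x ∉ tsupport φ, w x = 0) →
      (∀ n : ℕ, Integrable (fun x => logCutoff n x * w x)) ∧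
      Tendsto (fun n : ℕ => ∫ x, logCutoff n x * w x) atTop (𝓝 (∫ x, convexProfile 1 * w x)) := by
    intro w hw hw0
    have hm : ∀ n : ℕ, AEStronglyMeasurable (fun x => logCutoff n x * w x) := fun n =>
      (contDiff_logCutoff n).continuous.aestronglyMeasurable.mul hw.aestronglyMeasurable
    have hb : ∀ n : ℕ, ∀ x, ‖logCutoff n x * w x‖ ≤ B * |w x| := fun n x => by
      by_cases hx : x ∈ tsupport φ
      · rw [norm_mul, Real.norm_of_nonneg (logCutoff_nonneg n x)]
        exact mul_le_mul_of_nonneg_right (hB x (hR x hx) n).1 (norm_nonneg _)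
      · simp [hw0 x hx]
    have hi : Integrable (fun x => B * |w x|) := hw.abs.const_mul B
    refine ⟨fun n => hi.mono' (hm n) (Eventually.of_forall (hb n)),
      tendsto_integral_of_dominated_convergence _ hm hi
        (fun n => Eventually.of_forall (hb n)) ?_⟩
    filter_upwards [ae_ne_zero hN] with x hx using (tendsto_logCutoff hx).mul_const _
  obtain ⟨-, t1⟩ := key (integrable_testFunction_mul hf φ) fun x hx => by
    simp [image_eq_zero_of_notMem_tsupport hx]
  obtain ⟨i2, t2⟩ := key (integrable_lap_mul hu φ) fun x hx => by
    rw [lap_eq_zero (notMem_tsupport_iff_eventuallyEq.1 hx), zero_mul]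
  have hlim := (t1.add t2).neg
  have e0 : convexProfile 1 * (negLaplacian Ω (distOf Ω u) - distOf Ω f) φ =
      -((∫ x, convexProfile 1 * (φ x * f x)) + ∫ x, convexProfile 1 * (lap φ x * u x)) := by
    have : (negLaplacian Ω (distOf Ω u) - distOf Ω f) φ =
      negLaplacian Ω (distOf Ω u) φ - distOf Ω f φ := rfl
    rw [this, negLaplacian_distOf_apply hu, distOf_apply hf, integral_const_mul, integral_const_mul]
    ring
  have hsub : ∀ n x, (lap (fun y => φ y * logCutoff n y) x - logCutoff n x * lap φ x) * u x =
      lap (χ n) x * u x - logCutoff n x * (lap φ x * u x) := fun n x => by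
    rw [hχ']
    ring
  simp only [hsub]
  refine ⟨fun n => (integrable_lap_mul hu' (χ n)).sub (i2 n), ?_⟩
  rw [e0]
  refine hlim.congr fun n => ?_
  have h1 := congrArg (fun T : 𝓓'(punctured Ω, ℝ) => T (χ n)) heq
  simp only [negLaplacian_distOf_apply hu', distOf_apply hf'] at h1
  have h2 : ∫ x, χ n x * f x = ∫ x, logCutoff n x * (φ x * f x) := by
    refine integral_congr_ae (Eventually.of_forall fun x => ?_)
    simp only [hχ]
    ring
  rw [integral_sub (integrable_lap_mul hu' (χ n)) (i2 n)]
  linarith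

/-- If `-Δ u = f` off the origin and `u / ‖x‖` is integrable near the origin, then `-Δ u - f` is
a nonnegative multiple of the Dirac mass. -/
theorem exists_negLaplacian_eq_add_delta (hN : 2 ≤ N)
    (h0 : (0 : EuclideanSpace ℝ (Fin N)) ∈ Ω) (hu : LocallyIntegrableOn u Ω)
    (hf : LocallyIntegrableOn f Ω) (hu' : LocallyIntegrableOn u (punctured Ω))
    (hf' : LocallyIntegrableOn f (punctured Ω))
    (hun : LocallyIntegrableOn (fun x => ‖x‖⁻¹ * u x) Ω)
    (hu0 : ∀ᵐ x : EuclideanSpace ℝ (Fin N), x ∈ Ω → 0 ≤ u x)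
    (heq : negLaplacian (punctured Ω) (distOf (punctured Ω) u) = distOf (punctured Ω) f) :
    ∃ α : ℝ, 0 ≤ α ∧ negLaplacian Ω (distOf Ω u) = distOf Ω f + α • Distribution.delta 0 := by
  set T : 𝓓'(Ω, ℝ) := negLaplacian Ω (distOf Ω u) - distOf Ω f with hT
  have hlim := tendsto_integral_logCutoff hN hu hf hu' hf' heq
  have h1 := convexProfile_one_pos
  have hg : ∀ φ : 𝓓(Ω, ℝ), Integrable ((tsupport φ).indicator fun x => ‖x‖⁻¹ * u x) := fun φ =>
    (hun.integrableOn_compact_subset φ.tsupport_subset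
      φ.hasCompactSupport.isCompact).integrable_indicator (isClosed_tsupport _).measurableSet
  have hzero : ∀ (φ : 𝓓(Ω, ℝ)) (n : ℕ), ∀ x ∉ tsupport φ,
      lap (fun y => φ y * logCutoff n y) x - logCutoff n x * lap φ x = 0 := fun φ n x hx => by
    have hz := notMem_tsupport_iff_eventuallyEq.1 hx
    have hz' : (fun y => φ y * logCutoff n y) =ᶠ[𝓝 x] 0 := by
      filter_upwards [hz] with y hy
      rw [hy]
      simp
    rw [lap_eq_zero hz, lap_eq_zero hz']
    simp
  have hformula : ∀ (φ : 𝓓(Ω, ℝ)) (n : ℕ), ∀ x ≠ 0,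
      lap (fun y => φ y * logCutoff n y) x - logCutoff n x * lap φ x =
        2 * gradDot φ (logCutoff n) x + φ x * lap (logCutoff n) x := fun φ n x hx => by
    rw [lap_mul_logCutoff (fun x _ => φ.contDiff.contDiffAt) n hx]
    ring
  have hgrad : ∀ φ : 𝓓(Ω, ℝ), ∃ K, 0 ≤ K ∧ ∀ x ∈ tsupport φ, x ≠ 0 → ∀ n : ℕ,
      |2 * gradDot φ (logCutoff n) x| ≤ K * ((n + 1 : ℝ)⁻¹ * ‖x‖⁻¹) ∧
      lap (logCutoff n) x ≤ K * ((n + 1 : ℝ)⁻¹ * (‖x‖ ^ 2)⁻¹) := fun φ => by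
    obtain ⟨R, hR⟩ := φ.hasCompactSupport.isCompact.isBounded.exists_norm_le
    obtain ⟨B, hB0, hB⟩ := exists_logCutoff_bound hN R
    obtain ⟨L, hL⟩ := φ.contDiff.lipschitzWith_of_hasCompactSupport φ.hasCompactSupport (by simp)
    refine ⟨2 * (B * L) + B, by positivity, fun x hx hx0 n => ?_⟩
    obtain ⟨b1, b2⟩ := (hB x (hR x hx) n).2 hx0
    have hp : 0 ≤ (n + 1 : ℝ)⁻¹ * ‖x‖⁻¹ := by positivity
    constructor
    · rw [abs_mul, abs_two]
      have hD : ‖fderiv ℝ φ x‖ ≤ L := norm_fderiv_le_of_lipschitz ℝ hL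
      calc 2 * |gradDot φ (logCutoff n) x| ≤ 2 * (B * L * ((n + 1 : ℝ)⁻¹ * ‖x‖⁻¹)) := by
            refine mul_le_mul_of_nonneg_left ((b1 φ).trans ?_) zero_le_two
            gcongr
        _ ≤ _ := by nlinarith
    · refine b2.trans ?_
      gcongr
      exact le_add_of_nonneg_left (by positivity)
  have htend : ∀ M : ℝ, Tendsto (fun n : ℕ => (n + 1 : ℝ)⁻¹ * M) atTop (𝓝 0) := fun M => by
    have := (tendsto_one_div_add_atTop_nhds_zero_nat (𝕜 := ℝ)).mul_const M
    simpa using this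
  -- Since `|φ x| ≤ L * ‖x‖`, the term `φ Δζ_n` loses one power of `‖x‖⁻¹`, and everything is
  -- bounded by `(n + 1)⁻¹` times the integrable `‖x‖⁻¹ * u`.
  have hvanish : ∀ φ : 𝓓(Ω, ℝ), φ 0 = 0 → T φ = 0 := fun φ hφ => by
    obtain ⟨K, hK0, hK⟩ := hgrad φ
    obtain ⟨L, hL⟩ := φ.contDiff.lipschitzWith_of_hasCompactSupport φ.hasCompactSupport (by simp)
    have hb : ∀ n : ℕ, ∀ᵐ x : EuclideanSpace ℝ (Fin N),
        ‖(lap (fun y => φ y * logCutoff n y) x - logCutoff n x * lap φ x) * u x‖ ≤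
          (n + 1 : ℝ)⁻¹ * ((K + L * K) * |(tsupport φ).indicator (fun x => ‖x‖⁻¹ * u x) x|) := by
      intro n
      filter_upwards [ae_ne_zero hN] with x hx0
      by_cases hx : x ∈ tsupport φ
      · have hx' := norm_pos_iff.2 hx0
        obtain ⟨k1, k2⟩ := hK x hx hx0 n
        have k3 : |φ x| ≤ L * ‖x‖ := by
          have := hL.dist_le_mul x 0
          rwa [hφ, dist_zero_right, dist_zero_right] at this
        have k4 := lap_logCutoff_nonneg hN n hx0
        rw [Set.indicator_of_mem hx, hformula φ n x hx0, norm_mul, abs_mul, abs_of_pos (inv_pos.2 hx')]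
        have k5 : ‖2 * gradDot φ (logCutoff n) x + φ x * lap (logCutoff n) x‖ ≤
            K * ((n + 1 : ℝ)⁻¹ * ‖x‖⁻¹) +
              (L * ‖x‖) * (K * ((n + 1 : ℝ)⁻¹ * (‖x‖ ^ 2)⁻¹)) := by
          refine (norm_add_le _ _).trans (add_le_add k1 ?_)
          rw [norm_mul, Real.norm_of_nonneg k4]
          exact mul_le_mul k3 k2 k4 (by positivity)
        refine (mul_le_mul_of_nonneg_right k5 (norm_nonneg _)).trans_eq ?_
        rw [Real.norm_eq_abs]
        field_simp
      · rw [hzero φ n x hx, Set.indicator_of_notMem hx]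
        simp
    have hlim0 : Tendsto (fun n => ∫ x,
        (lap (fun y => φ y * logCutoff n y) x - logCutoff n x * lap φ x) * u x) atTop (𝓝 0) := by
      refine squeeze_zero_norm (fun n => ?_) (htend
        (∫ x, (K + L * K) * |(tsupport φ).indicator (fun x => ‖x‖⁻¹ * u x) x|))
      rw [← integral_const_mul]
      exact norm_integral_le_of_norm_le (((hg φ).abs.const_mul _).const_mul _) (hb n)
    have := tendsto_nhds_unique (hlim φ).2 hlim0
    exact (mul_eq_zero.1 this).resolve_left h1.ne'
  -- Here `φ Δζ_n u ≥ 0` is dropped, so only the gradient term has to be estimated.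
  have hpos : ∀ φ : 𝓓(Ω, ℝ), (∀ x, 0 ≤ φ x) → 0 ≤ T φ := fun φ hφ => by
    obtain ⟨K, hK0, hK⟩ := hgrad φ
    have hb : ∀ n : ℕ, -((n + 1 : ℝ)⁻¹ *
        ∫ x, K * |(tsupport φ).indicator (fun x => ‖x‖⁻¹ * u x) x|) ≤
        ∫ x, (lap (fun y => φ y * logCutoff n y) x - logCutoff n x * lap φ x) * u x := by
      intro n
      rw [← integral_const_mul, ← integral_neg]
      refine integral_mono_ae (((hg φ).abs.const_mul _).const_mul _).neg ((hlim φ).1 n) ?_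
      filter_upwards [ae_ne_zero hN, hu0] with x hx0 hux
      by_cases hx : x ∈ tsupport φ
      · have hx' := norm_pos_iff.2 hx0
        specialize hux (φ.tsupport_subset hx)
        rw [Set.indicator_of_mem hx, hformula φ n x hx0, abs_of_nonneg (by positivity)]
        have k1 := neg_le_of_abs_le (hK x hx hx0 n).1
        have k2 := mul_nonneg (hφ x) (lap_logCutoff_nonneg hN n hx0)
        calc -((n + 1 : ℝ)⁻¹ * (K * (‖x‖⁻¹ * u x))) = -(K * ((n + 1 : ℝ)⁻¹ * ‖x‖⁻¹)) * u x := by ring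
          _ ≤ _ := mul_le_mul_of_nonneg_right (by linarith) hux
      · rw [hzero φ n x hx, Set.indicator_of_notMem hx]
        simp
    have h2 := le_of_tendsto_of_tendsto' (by simpa using (htend _).neg) (hlim φ).2 hb
    exact nonneg_of_mul_nonneg_right h2 h1
  obtain ⟨R, hR, hRΩ⟩ := Metric.nhds_basis_closedBall.mem_iff.1 (Ω.isOpen.mem_nhds h0)
  let b : ContDiffBump (0 : EuclideanSpace ℝ (Fin N)) := ⟨R / 2, R, by linarith, by linarith⟩
  let η : 𝓓(Ω, ℝ) := ⟨b, b.contDiff, b.hasCompactSupport, b.tsupport_eq ▸ hRΩ⟩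
  have hη0 : η 0 = 1 := b.one_of_mem_closedBall (Metric.mem_closedBall_self b.rIn_pos.le)
  refine ⟨T η, hpos η fun x => b.nonneg, ?_⟩
  have hTd : T = T η • (Distribution.delta 0 : 𝓓'(Ω, ℝ)) := by
    ext φ
    -- Subtracting `φ 0 • η` makes the test function vanish at the origin, so `T φ = φ 0 * T η`.
    have h3 := hvanish (φ - φ 0 • η) (by simp [hη0])
    rw [map_sub, map_smul, sub_eq_zero] at h3
    rw [h3]
    simp [mul_comm]
  rw [← hTd, hT, add_sub_cancel]

/-- **Brézis–Lions lemma**. -/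
theorem exists_negLaplacian_eq_add_delta_of_nonneg (hN : 2 ≤ N)
    (h0 : (0 : EuclideanSpace ℝ (Fin N)) ∈ Ω)
    (hu : LocallyIntegrableOn u (punctured Ω)) (hf : LocallyIntegrableOn f (punctured Ω))
    (hu0 : ∀ᵐ x : EuclideanSpace ℝ (Fin N), x ∈ Ω → 0 ≤ u x)
    (hf0 : ∀ᵐ x : EuclideanSpace ℝ (Fin N), x ∈ Ω → 0 ≤ f x)
    (heq : negLaplacian (punctured Ω) (distOf (punctured Ω) u) = distOf (punctured Ω) f) :
    LocallyIntegrableOn u Ω ∧ LocallyIntegrableOn f Ω ∧ ∃ α : ℝ, 0 ≤ α ∧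
      negLaplacian Ω (distOf Ω u) = distOf Ω f + α • Distribution.delta 0 := by
  obtain ⟨r, hr, hfr, hur⟩ := exists_integrableOn_ball hN h0 hu hf hu0 hf0 heq
  have hf1 := locallyIntegrableOn_of_punctured hf hr hfr
  have hun := locallyIntegrableOn_of_punctured (locallyIntegrableOn_norm_inv_mul hu) hr hur
  -- `u` is recovered as `‖x‖ * (‖x‖⁻¹ * u)`, an identity that may fail only at the null set `{0}`.
  have hu1 : LocallyIntegrableOn u Ω := by
    have h := hun.continuousOn_mul continuous_norm.continuousOn Ω.isOpen.isLocallyClosed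
    refine fun x hx => ?_
    obtain ⟨s, hs, hi⟩ := h x hx
    refine ⟨s, hs, hi.congr ?_⟩
    filter_upwards [ae_restrict_of_ae (ae_ne_zero hN)] with y hy
    rw [mul_inv_cancel_left₀ (norm_ne_zero_iff.2 hy)]
  exact ⟨hu1, hf1, exists_negLaplacian_eq_add_delta hN h0 hu1 hf1 hu hf hun hu0 heq⟩

/-- The fundamental lemma of the calculus of variations. It serves to transfer the sign of the weak
representative for `k = 0` to `u` itself. -/
theorem ae_eq_of_distOf_eq {v w : EuclideanSpace ℝ (Fin N) → ℝ} (hv : LocallyIntegrableOn v Ω)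
    (hw : LocallyIntegrableOn w Ω) (h : distOf Ω v = distOf Ω w) :
    ∀ᵐ x : EuclideanSpace ℝ (Fin N), x ∈ Ω → v x = w x := by
  have key := IsOpen.ae_eq_zero_of_integral_contDiff_smul_eq_zero (μ := volume) Ω.isOpen
    (hv.sub hw) fun φ h1 h2 h3 => by
      have h4 := congrArg (fun T : 𝓓'(Ω, ℝ) => T ⟨φ, h1, h2, h3⟩) h
      simp only [distOf_apply hv, distOf_apply hw] at h4
      have i1 := integrable_testFunction_mul hv ⟨φ, h1, h2, h3⟩
      have i2 := integrable_testFunction_mul hw ⟨φ, h1, h2, h3⟩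
      have h5 := (integral_sub i1 i2).trans (sub_eq_zero.2 h4)
      rw [← h5]
      refine integral_congr_ae (Eventually.of_forall fun x => ?_)
      exact mul_sub _ _ _
  filter_upwards [key] with x hx hxΩ using sub_eq_zero.1 (hx hxΩ)

end Removable

/-! ### Iteration and the main theorem. -/

/-- Iteration of the Brézis–Lions lemma along a chain `v (k + 1) = -Δ (v k)` of nonnegative
functions on the punctured set. -/
theorem exists_negLaplacian_pow_eq {N : ℕ} {Ω : Opens (EuclideanSpace ℝ (Fin N))} (hN : 2 ≤ N)
    (h0 : (0 : EuclideanSpace ℝ (Fin N)) ∈ Ω) (v : ℕ → EuclideanSpace ℝ (Fin N) → ℝ) (m : ℕ)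
    (hv : ∀ k ≤ m, LocallyIntegrableOn (v k) (punctured Ω))
    (hv0 : ∀ k ≤ m, ∀ᵐ x : EuclideanSpace ℝ (Fin N), x ∈ Ω → 0 ≤ v k x)
    (hstep : ∀ k < m, negLaplacian (punctured Ω) (distOf (punctured Ω) (v k)) =
      distOf (punctured Ω) (v (k + 1))) :
    ∃ α : Fin m → ℝ, (∀ i, 0 ≤ α i) ∧ (negLaplacian Ω ^ m) (distOf Ω (v 0)) =
      distOf Ω (v m) + ∑ i : Fin m, α i • (negLaplacian Ω ^ (i : ℕ)) (Distribution.delta 0) := by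
  induction m with
  | zero => exact ⟨Fin.elim0, fun i => i.elim0, by simp⟩
  | succ m ih =>
    obtain ⟨α, hα, h⟩ := ih (fun k hk => hv k (by omega)) (fun k hk => hv0 k (by omega))
      fun k hk => hstep k (by omega)
    obtain ⟨-, -, β, hβ, h'⟩ := exists_negLaplacian_eq_add_delta_of_nonneg hN h0
      (hv m (by omega)) (hv (m + 1) le_rfl) (hv0 m (by omega)) (hv0 (m + 1) le_rfl)
      (hstep m (by omega))
    -- Applying `-Δ` once more raises every earlier exponent by one; the new mass `β` takes the
    -- vacant exponent `0`.
    refine ⟨Fin.cons β α, Fin.cases hβ hα, ?_⟩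
    rw [pow_succ', mul_apply_eq_comp, h, map_add, h', map_sum, Fin.sum_univ_succ,
      add_assoc]
    simp [pow_succ']

theorem theorem4p1 (N m : ℕ) (hm : 1 ≤ m) (hN : 2 * m ≤ N)
    (Ω : Opens (EuclideanSpace ℝ (Fin N))) (h0 : (0 : EuclideanSpace ℝ (Fin N)) ∈ Ω)
    (g : EuclideanSpace ℝ (Fin N) → ℝ → ℝ)
    (hg_meas : AEMeasurable (fun p : EuclideanSpace ℝ (Fin N) × ℝ => g p.1 p.2)
      (volume.restrict ((punctured Ω : Set (EuclideanSpace ℝ (Fin N))) ×ˢ Set.Ici (0 : ℝ))))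
    (hg_nonneg : ∀ x ∈ punctured Ω, ∀ t : ℝ, 0 ≤ t → 0 ≤ g x t)
    (u : EuclideanSpace ℝ (Fin N) → ℝ)
    (hu : ∀ k < m, ∃ v : EuclideanSpace ℝ (Fin N) → ℝ,
      IsWeakPolyLaplacian (punctured Ω) k u v ∧
        ∀ᵐ x ∂volume.restrict (punctured Ω : Set (EuclideanSpace ℝ (Fin N))), 0 ≤ v x)
    (heq : IsWeakPolyLaplacian (punctured Ω) m u (fun x => g x (u x))) :
    LocallyIntegrableOn u Ω ∧
    LocallyIntegrableOn (fun x => g x (u x)) Ω ∧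
    ∃ α : Fin m → ℝ, (∀ i, 0 ≤ α i) ∧
      (negLaplacian Ω ^ m) (distOf Ω u) =
        distOf Ω (fun x => g x (u x)) +
          ∑ i : Fin m, α i • (negLaplacian Ω ^ (i : ℕ)) (Distribution.delta 0) := by
  have hN2 : 2 ≤ N := by omega
  choose! w hw hw0 using hu
  have hwu : ∀ᵐ x ∂volume.restrict (punctured Ω : Set (EuclideanSpace ℝ (Fin N))), 0 ≤ u x := by
    obtain ⟨h1, h2, h3⟩ := hw 0 (by omega)
    have h4 := ae_eq_of_distOf_eq h1 h2 (by simpa using h3)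
    filter_upwards [hw0 0 (by omega),
      (ae_restrict_iff' (punctured Ω).isOpen.measurableSet).2 h4] with x hx1 hx2
    rwa [hx2]
  have hgu : ∀ᵐ x ∂volume.restrict (punctured Ω : Set (EuclideanSpace ℝ (Fin N))),
      0 ≤ g x (u x) := by
    filter_upwards [hwu, ae_restrict_mem (punctured Ω).isOpen.measurableSet] with x hx hxΩ
      using hg_nonneg x hxΩ _ hx
  have chain : ∃ v : ℕ → EuclideanSpace ℝ (Fin N) → ℝ, v 0 = u ∧ v m = (fun x => g x (u x)) ∧
      ∀ k ≤ m, IsWeakPolyLaplacian (punctured Ω) k u (v k) ∧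
        ∀ᵐ x ∂volume.restrict (punctured Ω : Set (EuclideanSpace ℝ (Fin N))), 0 ≤ v k x := by
    -- At the two ends the chain must be `u` and `g x (u x)` on the nose, so chosen representatives
    -- are used only for `0 < k < m`.
    refine ⟨fun k => if k = 0 then u else if k = m then fun x => g x (u x) else w k, by simp,
      by simp [show m ≠ 0 by omega], fun k hk => ?_⟩
    beta_reduce
    split_ifs with hk0 hkm
    · subst hk0
      exact ⟨⟨heq.1, heq.1, by simp⟩, hwu⟩
    · subst hkm
      exact ⟨heq, hgu⟩
    · exact ⟨hw k (by omega), hw0 k (by omega)⟩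
  obtain ⟨v, rfl, hvm, hv⟩ := chain
  rw [← hvm]
  have hv0 : ∀ k ≤ m, ∀ᵐ x : EuclideanSpace ℝ (Fin N), x ∈ Ω → 0 ≤ v k x := fun k hk =>
    ae_of_ae_restrict_punctured hN2 (hv k hk).2
  have hstep : ∀ k < m, negLaplacian (punctured Ω) (distOf (punctured Ω) (v k)) =
      distOf (punctured Ω) (v (k + 1)) := fun k hk => by
    rw [← (hv k hk.le).1.2.2, ← (hv (k + 1) hk).1.2.2, pow_succ', mul_apply_eq_comp]
  have bl : ∀ k < m, LocallyIntegrableOn (v k) Ω ∧ LocallyIntegrableOn (v (k + 1)) Ω := fun k hk => by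
    obtain ⟨h1, h2, -⟩ := exists_negLaplacian_eq_add_delta_of_nonneg hN2 h0 (hv k hk.le).1.2.1
      (hv (k + 1) hk).1.2.1 (hv0 k hk.le) (hv0 (k + 1) hk) (hstep k hk)
    exact ⟨h1, h2⟩
  refine ⟨(bl 0 (by omega)).1, ?_, exists_negLaplacian_pow_eq hN2 h0 v m
    (fun k hk => (hv k hk).1.2.1) hv0 hstep⟩
  -- The last link, from `m - 1` to `m`, gives the integrability of `g x (u x)`.
  have := (bl (m - 1) (by omega)).2
  rwa [Nat.sub_add_cancel hm] at this
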